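/- Let $V_1,\dots,V_N$ be non-zero linear subspaces of $\mathbb{R}^n$, with $d_j=\dim V_j$, let $P_j$ be the orthogonal projection of $\mathbb{R}^n$ onto $V_j$, and let $1\le p_j<\infty$ for $j=1,\dots,N$. Let $\gamma_n$ be the standard Gaussian measure on $\mathbb{R}^n$, with density $(2\pi)^{-n/2}e^{-|x|^2/2}$ with respect to Lebesgue measure, and let $\gamma_{d_j}$ be the standard Gaussian measure on the Euclidean space $V_j$, with density $(2\pi)^{-d_j/2}e^{-|y|^2/2}$ with respect to Lebesgue measure on $V_j$. Then there is a finite constant $C\ge 0$ such that $$\int_{\mathbb{R}^n}\prod_{j=1}^N f_j(P_jx)\,d\gamma_n(x)\ \le\ C\prod_{j=1}^N\left(\int_{V_j}f_j(y)^{p_j}\,d\gamma_{d_j}(y)\right)^{1/p_j}$$ holds for all non-negative measurable functions $f_j:V_j\to[0,\infty)$, $j=1,\dots,N$ (integrals take values in $[0,\infty]$, with $0\cdot\infty=0$), if and only if $$\sum_{j=1}^N\frac1{p_j}P_j\ \le\ \mathrm{Id}_{\mathbb{R}^n}$$ in the sense of quadratic forms. Moreover, in this case the smallest constant $C$ for which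 the inequality holds for all such $f_j$ is $C=1$. -/

import Mathlib

open MeasureTheory ProbabilityTheory
open scoped ENNReal NNReal

/-- The Gaussian Brascamp-Lieb inequality with constant `C`, for the subspaces `V j` of `ℝⁿ` and
the exponents `p j`: for all non-negative measurable functions `f j` on `V j`,
`∫ ∏ j, f j (P j x) dγ(x) ≤ C * ∏ j, (∫ (f j) ^ (p j) dγ_j) ^ (1 / p j)`,
where `P j` is the orthogonal projection of `ℝⁿ` onto `V j`, and `γ`, `γ_j` are the standard
Gaussian measures of the Euclidean spaces `ℝⁿ` and `V j`. Both sides may be infinite. -/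
def GaussianBrascampLieb {n N : ℕ} (V : Fin N → Submodule ℝ (EuclideanSpace ℝ (Fin n)))
    (p : Fin N → ℝ) (C : ℝ≥0) : Prop :=
  ∀ f : (j : Fin N) → V j → ℝ≥0, (∀ j, Measurable (f j)) →
    ∫⁻ x, ∏ j, (f j ((V j).orthogonalProjectionOnto x) : ℝ≥0∞)
        ∂(stdGaussian (EuclideanSpace ℝ (Fin n))) ≤
      (C : ℝ≥0∞) * ∏ j, (∫⁻ y, (f j y : ℝ≥0∞) ^ p j ∂(stdGaussian (V j))) ^ (1 / p j)

/-!
Write `θ j = 1 / p j`. The operator inequality `∑ j, θ j • P j ≤ Id` is equivalent to its dual form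
`‖∑ j, θ j • w j‖² ≤ ∑ j, θ j * ‖w j‖²` for all `w j ∈ V j` (`norm_sum_smul_sq_le`,
`sum_mul_norm_sq_le_of_norm_sum_smul_sq_le`), and both directions go through the dual form.

*Necessity.* For `f j = exp ⟪w j, ·⟫` both sides of the Brascamp-Lieb inequality are explicit, and
it reads `exp (‖∑ j, w j‖² / 2) ≤ C * exp (∑ j, p j * ‖w j‖² / 2)`. Replacing `w` by `t • w` and
letting `t` be large removes `C`; the substitution `w j ↦ θ j • w j` gives the dual form. Constant
functions show `1 ≤ C`.

*Sufficiency, with constant `1`.* With `F j = f j ^ p j`, the claim is that Gaussian averaging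
increases the geometric mean: `𝔼 ∏ j, F j (P j z) ^ θ j ≤ ∏ j, (𝔼 F j (P j z)) ^ θ j`. This is a
discrete version of the monotonicity of `∏ j, (Q_t F j) ^ θ j` under the heat flow `Q_t`. For a
displacement `s • z` with `s` small, a second-order expansion of both sides
(`exists_prod_one_add_rpow_le`, `one_add_sum_sub_le_prod_rpow`) shows that they differ at order `s²`
by half of the second moment of `∑ j, θ j * ⟪w j, z⟫` minus `∑ j, θ j * 𝔼 ⟪w j, z⟫²`, where
`w j ∈ V j` is the gradient of `log (F j ∘ P j)`. That is not positive by the dual form, so the inequality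
holds up to an error `K * s³` (`exists_integral_prod_rpow_le_of_small_displacement`). The constant
`K` depends only on bounds for `F j` and for its gradient which averaging preserves (`IsTame`,
`IsTame.average`). The inequality may therefore be applied successively to `m` independent
increments of size `s = 1 / √m`, whose sum is again standard Gaussian; the total error is `K / √m`,
and `m → ∞` gives the claim for functions with these bounds (`IsTame.integral_prod_rpow_le`).

The functions `φ² + δ` with `φ` smooth and compactly supported are of this kind. Approximating the
square root of `F j` in `L²` by such `φ`, with almost everywhere convergence, and applying Fatou's
lemma extends the inequality to bounded measurable functions (`lintegral_prod_le_of_bounded`), and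
truncation extends it to all of them (`lintegral_prod_le`).
-/

/-! ### Scalar inequalities -/

/-- The third-order Taylor upper bound for the logarithm holds on the whole domain `r > -1`:
the difference of the two sides has derivative `r ^ 3 / (1 + r)`, so it is minimal at `0`. -/
lemma log_one_add_le_cubic {r : ℝ} (hr : -1 < r) :
    Real.log (1 + r) ≤ r - r ^ 2 / 2 + r ^ 3 / 3 := by
  set φ : ℝ → ℝ := fun r ↦ r - r ^ 2 / 2 + r ^ 3 / 3 - Real.log (1 + r) with hφ
  have hd : ∀ x : ℝ, -1 < x → HasDerivAt φ (x ^ 3 / (1 + x)) x := by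
    intro x hx
    have h1 : (1 + x) ≠ 0 := by linarith
    have h2 : HasDerivAt (fun x : ℝ ↦ Real.log (1 + x)) (1 / (1 + x)) x :=
      ((hasDerivAt_id x).const_add 1).log h1
    have h3 := (((hasDerivAt_id x).sub (((hasDerivAt_id x).pow 2).div_const 2)).add
      (((hasDerivAt_id x).pow 3).div_const 3)).sub h2
    refine h3.congr_deriv ?_
    simp only [id]
    field_simp
    ring
  have h0 : φ 0 = 0 := by simp [hφ]
  suffices 0 ≤ φ r by
    simp only [hφ] at this
    linarith
  rw [← h0]
  rcases le_total 0 r with h | h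
  · have hmono : MonotoneOn φ (Set.Ici 0) := by
      refine monotoneOn_of_deriv_nonneg (convex_Ici 0)
        (fun x hx ↦ (hd x ?_).continuousAt.continuousWithinAt) (fun x hx ↦ ?_) fun x hx ↦ ?_
      · have : (0 : ℝ) ≤ x := hx
        linarith
      · rw [interior_Ici] at hx
        have : (0 : ℝ) < x := hx
        exact (hd x (by linarith)).differentiableAt.differentiableWithinAt
      · rw [interior_Ici] at hx
        have : (0 : ℝ) < x := hx
        rw [(hd x (by linarith)).deriv]
        positivity
    exact hmono (Set.mem_Ici.2 le_rfl) h h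
  · have hanti : AntitoneOn φ (Set.Ioc (-1) 0) := by
      refine antitoneOn_of_deriv_nonpos (convex_Ioc _ _)
        (fun x hx ↦ (hd x hx.1).continuousAt.continuousWithinAt) (fun x hx ↦ ?_) fun x hx ↦ ?_
      · rw [interior_Ioc] at hx
        exact (hd x hx.1).differentiableAt.differentiableWithinAt
      · rw [interior_Ioc] at hx
        rw [(hd x hx.1).deriv]
        have h1 : 0 < 1 + x := by linarith [hx.1]
        exact div_nonpos_of_nonpos_of_nonneg
          (by nlinarith [hx.2, sq_nonneg x]) h1.le
    exact hanti ⟨hr, h⟩ ⟨by norm_num, le_rfl⟩ h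

lemma exp_le_one_add_add_sq_add_cube (x : ℝ) :
    Real.exp x ≤ 1 + x + x ^ 2 / 2 + |x| ^ 3 * Real.exp |x| := by
  have h := Complex.norm_exp_sub_sum_le_norm_mul_exp (x : ℂ) 3
  have h2 : Complex.exp (x : ℂ) - ∑ m ∈ Finset.range 3, (x : ℂ) ^ m / (m.factorial : ℂ)
      = ((Real.exp x - (1 + x + x ^ 2 / 2) : ℝ) : ℂ) := by
    simp [Finset.sum_range_succ, Nat.factorial]
  rw [h2, Complex.norm_real, Complex.norm_real, Real.norm_eq_abs, Real.norm_eq_abs] at h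
  linarith [le_abs_self (Real.exp x - (1 + x + x ^ 2 / 2))]

section WeightedProducts

variable {ι : Type*} [Fintype ι] {θ : ι → ℝ}

lemma abs_sum_mul_le (hθ : ∀ j, 0 ≤ θ j) {x : ι → ℝ} {B : ℝ} (hx : ∀ j, |x j| ≤ B) :
    |∑ j, θ j * x j| ≤ (∑ j, θ j) * B := by
  rw [Finset.sum_mul]
  refine (Finset.abs_sum_le_sum_abs _ _).trans (Finset.sum_le_sum fun j _ ↦ ?_)
  rw [abs_mul, abs_of_nonneg (hθ j)]
  exact mul_le_mul_of_nonneg_left (hx j) (hθ j)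

/-- Second-order expansion of a weighted geometric mean, with a remainder that is cubic in the size
`t` of the displacement: `r` is the vector of relative increments and `ℓ` its linear part. -/
lemma exists_prod_one_add_rpow_le (hθ : ∀ j, 0 ≤ θ j) {R c : ℝ} (hR : 0 ≤ R) (hc : 0 ≤ c) :
    ∃ K : ℝ, 0 ≤ K ∧ ∀ (r ℓ : ι → ℝ) (t : ℝ), 0 ≤ t → (∀ j, -1 < r j) → (∀ j, |r j| ≤ R) →
      (∀ j, |r j| ≤ c * t) → (∀ j, |ℓ j| ≤ c * t) → (∀ j, |r j - ℓ j| ≤ c * t ^ 2) →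
      ∏ j, (1 + r j) ^ θ j ≤ 1 + ∑ j, θ j * r j
        + ((∑ j, θ j * ℓ j) ^ 2 - ∑ j, θ j * ℓ j ^ 2) / 2 + K * t ^ 3 := by
  set T := ∑ j, θ j with hT
  have hT0 : 0 ≤ T := Finset.sum_nonneg fun j _ ↦ hθ j
  set D := T * (1 + R + R ^ 2) with hD
  have hD0 : 0 ≤ D := by positivity
  refine ⟨T * c ^ 3 + T * c ^ 2 + T ^ 2 * c ^ 2 + T * (1 + R) * c ^ 2 * (D * c)
    + (D * c) ^ 3 * Real.exp (D * R), by positivity, ?_⟩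
  intro r ℓ t ht hr1 hrR hrt hℓt hrℓ
  set X := ∑ j, θ j * (r j - r j ^ 2 / 2 + r j ^ 3 / 3) with hX
  set Y := ∑ j, θ j * r j with hY
  set L := ∑ j, θ j * ℓ j with hL
  have hprod : ∏ j, (1 + r j) ^ θ j ≤ Real.exp X := by
    rw [hX, Real.exp_sum]
    refine Finset.prod_le_prod (fun j _ ↦ Real.rpow_nonneg (by linarith [hr1 j]) _) fun j _ ↦ ?_
    rw [Real.rpow_def_of_pos (by linarith [hr1 j]), Real.exp_le_exp, mul_comm]
    exact mul_le_mul_of_nonneg_left (log_one_add_le_cubic (hr1 j)) (hθ j)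
  have hbase : ∀ j, |r j - r j ^ 2 / 2 + r j ^ 3 / 3| ≤ (1 + R + R ^ 2) * |r j| := by
    intro j
    have h1 : r j - r j ^ 2 / 2 + r j ^ 3 / 3 = (1 - r j / 2 + r j ^ 2 / 3) * r j := by ring
    rw [h1, abs_mul]
    refine mul_le_mul_of_nonneg_right ?_ (abs_nonneg _)
    have h2 : r j ^ 2 ≤ R ^ 2 := sq_le_sq' (abs_le.1 (hrR j)).1 (abs_le.1 (hrR j)).2
    have h3 := abs_le.1 (hrR j)
    rw [abs_le]
    constructor <;> nlinarith [sq_nonneg (r j)]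
  have hct : 0 ≤ c * t := by positivity
  have hXt : |X| ≤ D * c * t := by
    refine (abs_sum_mul_le hθ (B := (1 + R + R ^ 2) * (c * t)) fun j ↦ ?_).trans_eq
      (by rw [hD]; ring)
    exact (hbase j).trans (mul_le_mul_of_nonneg_left (hrt j) (by positivity))
  have hXR : |X| ≤ D * R := by
    refine (abs_sum_mul_le hθ (B := (1 + R + R ^ 2) * R) fun j ↦ ?_).trans_eq (by rw [hD]; ring)
    exact (hbase j).trans (mul_le_mul_of_nonneg_left (hrR j) (by positivity))
  have hYt : |Y| ≤ T * (c * t) := abs_sum_mul_le hθ hrt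
  have hLt : |L| ≤ T * (c * t) := abs_sum_mul_le hθ hℓt
  have hTD : T ≤ D := by
    rw [hD]; nlinarith [mul_nonneg hT0 hR, mul_nonneg hT0 (sq_nonneg R)]
  have hYD : |Y| ≤ D * c * t := hYt.trans (by nlinarith)
  -- the quadratic term appears with the right sign in the logarithm
  have hXY : X ≤ Y - (∑ j, θ j * r j ^ 2) / 2 + T * c ^ 3 * t ^ 3 := by
    have : T * c ^ 3 * t ^ 3 = ∑ j, θ j * (c * t) ^ 3 := by rw [← Finset.sum_mul]; ring
    rw [this, hX, hY, Finset.sum_div, ← Finset.sum_sub_distrib, ← Finset.sum_add_distrib]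
    refine Finset.sum_le_sum fun j _ ↦ ?_
    have h3 : r j ^ 3 ≤ (c * t) ^ 3 :=
      (le_abs_self _).trans (by rw [abs_pow]; exact pow_le_pow_left₀ (abs_nonneg _) (hrt j) 3)
    have h4 : (0 : ℝ) ≤ (c * t) ^ 3 := by positivity
    have := mul_le_mul_of_nonneg_left
      (show r j - r j ^ 2 / 2 + r j ^ 3 / 3 ≤ r j - r j ^ 2 / 2 + (c * t) ^ 3 by linarith) (hθ j)
    linarith
  have hXYabs : |X - Y| ≤ T * (1 + R) * c ^ 2 * t ^ 2 := by
    have h1 : X - Y = ∑ j, θ j * ((- 1 / 2 + r j / 3) * r j ^ 2) := by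
      rw [hX, hY, ← Finset.sum_sub_distrib]
      exact Finset.sum_congr rfl fun j _ ↦ by ring
    rw [h1]
    refine (abs_sum_mul_le hθ (B := (1 + R) * (c * t) ^ 2) fun j ↦ ?_).trans_eq (by ring)
    rw [abs_mul, abs_pow]
    have h3 := abs_le.1 (hrR j)
    refine mul_le_mul ?_ (pow_le_pow_left₀ (abs_nonneg _) (hrt j) 2) (by positivity) (by positivity)
    rw [abs_le]
    constructor <;> linarith
  have hX2 : X ^ 2 ≤ Y ^ 2 + 2 * (T * (1 + R) * c ^ 2 * (D * c)) * t ^ 3 := by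
    have h1 : X ^ 2 - Y ^ 2 ≤ |X - Y| * |X + Y| := by
      rw [← abs_mul]; exact (le_abs_self _).trans_eq' (by ring)
    have h2 : |X + Y| ≤ 2 * (D * c * t) := (abs_add_le _ _).trans (by linarith)
    have h3 := mul_le_mul hXYabs h2 (abs_nonneg _) (by positivity)
    nlinarith
  have hY2 : Y ^ 2 ≤ L ^ 2 + 2 * (T ^ 2 * c ^ 2) * t ^ 3 := by
    have h0 : |Y - L| ≤ T * (c * t ^ 2) := by
      have h1 : Y - L = ∑ j, θ j * (r j - ℓ j) := by
        rw [hL, hY, ← Finset.sum_sub_distrib]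
        exact Finset.sum_congr rfl fun j _ ↦ by ring
      rw [h1]
      exact abs_sum_mul_le hθ hrℓ
    have h1 : Y ^ 2 - L ^ 2 ≤ |Y - L| * |Y + L| := by
      rw [← abs_mul]; exact (le_abs_self _).trans_eq' (by ring)
    have h2 : |Y + L| ≤ 2 * (T * (c * t)) := (abs_add_le _ _).trans (by linarith)
    have h3 := mul_le_mul h0 h2 (abs_nonneg _) (by positivity)
    nlinarith
  have hQ : ∑ j, θ j * ℓ j ^ 2 ≤ (∑ j, θ j * r j ^ 2) + 2 * (T * c ^ 2) * t ^ 3 := by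
    have : 2 * (T * c ^ 2) * t ^ 3 = ∑ j, θ j * (2 * c ^ 2 * t ^ 3) := by
      rw [← Finset.sum_mul]; ring
    rw [this, ← Finset.sum_add_distrib]
    refine Finset.sum_le_sum fun j _ ↦ ?_
    rw [← mul_add]
    refine mul_le_mul_of_nonneg_left ?_ (hθ j)
    have h1 : ℓ j ^ 2 - r j ^ 2 ≤ |r j - ℓ j| * |r j + ℓ j| := by
      rw [← abs_mul, ← abs_neg]; exact (le_abs_self _).trans_eq' (by ring)
    have h2 : |r j + ℓ j| ≤ 2 * (c * t) := (abs_add_le _ _).trans (by linarith [hrt j, hℓt j])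
    have h3 := mul_le_mul (hrℓ j) h2 (abs_nonneg _) (by positivity)
    nlinarith
  have hcube : |X| ^ 3 * Real.exp |X| ≤ (D * c) ^ 3 * Real.exp (D * R) * t ^ 3 := by
    have h1 := pow_le_pow_left₀ (abs_nonneg _) hXt 3
    have h2 := mul_le_mul h1 (Real.exp_le_exp.2 hXR) (Real.exp_pos _).le (by positivity)
    refine h2.trans_eq (by ring)
  have hE := exp_le_one_add_add_sq_add_cube X
  calc _ ≤ _ := hprod
    _ ≤ _ := hE
    _ ≤ _ := by linarith

/-- Lower bound for a weighted geometric mean. The condition `1 ≤ (1 + m j) * D` says that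
`1 + m j` stays away from `0`. -/
lemma one_add_sum_sub_le_prod_rpow (hθ : ∀ j, 0 ≤ θ j) {D : ℝ} {m : ι → ℝ}
    (hm : ∀ j, -1 < m j) (hD : ∀ j, 1 ≤ (1 + m j) * D) :
    1 + ∑ j, θ j * (m j - D * m j ^ 2) ≤ ∏ j, (1 + m j) ^ θ j := by
  have h : ∏ j, (1 + m j) ^ θ j = Real.exp (∑ j, θ j * Real.log (1 + m j)) := by
    rw [Real.exp_sum]
    refine Finset.prod_congr rfl fun j _ ↦ ?_
    rw [Real.rpow_def_of_pos (by linarith [hm j]), mul_comm]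
  rw [h, add_comm]
  refine le_trans ?_ (Real.add_one_le_exp _)
  gcongr with j
  · exact hθ j
  have hpos : 0 < 1 + m j := by linarith [hm j]
  have h1 := Real.one_sub_inv_le_log_of_pos hpos
  refine le_trans ?_ h1
  have h2 : 1 - (1 + m j)⁻¹ = m j - m j ^ 2 * (1 + m j)⁻¹ := by field_simp; ring
  rw [h2]
  have h3 : (1 + m j)⁻¹ ≤ D := by
    rw [inv_le_iff_one_le_mul₀' hpos]; exact hD j
  nlinarith [sq_nonneg (m j)]

end WeightedProducts

/-! ### Standard Gaussian measures -/

section Gaussian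

variable {E : Type*} [NormedAddCommGroup E] [InnerProductSpace ℝ E] [FiniteDimensional ℝ E]
  [MeasurableSpace E] [BorelSpace E]

open scoped RealInnerProductSpace

/-- The orthogonal projection onto a subspace sends the standard Gaussian measure to the standard
Gaussian measure of the subspace. -/
lemma stdGaussian_map_orthogonalProjectionOnto (V : Submodule ℝ E) :
    (stdGaussian E).map V.orthogonalProjectionOnto = stdGaussian V := by
  have : IsProbabilityMeasure ((stdGaussian E).map V.orthogonalProjectionOnto) :=
    Measure.isProbabilityMeasure_map (by fun_prop)
  refine Measure.ext_of_charFun (funext fun t ↦ ?_)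
  rw [charFun_stdGaussian, charFun_apply, integral_map (by fun_prop) (by fun_prop)]
  have h : ∀ x : E, ⟪V.orthogonalProjectionOnto x, t⟫ = ⟪x, (t : E)⟫ := fun x ↦
    Submodule.inner_orthogonalProjectionOnto_eq_of_mem_right t x
  simp_rw [h]
  rw [← charFun_apply, charFun_stdGaussian, Submodule.coe_norm]

/-- Stability of the standard Gaussian measure: the sum of two independent Gaussian vectors, scaled
by `s` and `t`, is a Gaussian vector scaled by `√(s² + t²)`. -/
lemma stdGaussian_map_smul_conv (s t : ℝ) :
    (stdGaussian E).map (s • ·) ∗ (stdGaussian E).map (t • ·)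
      = (stdGaussian E).map (√(s ^ 2 + t ^ 2) • ·) := by
  have h : ∀ r : ℝ, IsProbabilityMeasure ((stdGaussian E).map (r • ·)) := fun r ↦
    Measure.isProbabilityMeasure_map (by fun_prop)
  refine Measure.ext_of_charFun (funext fun u ↦ ?_)
  rw [charFun_conv]
  simp_rw [charFun_map_smul, charFun_stdGaussian, ← Complex.exp_add]
  congr 1
  simp only [norm_smul, mul_pow, Real.norm_eq_abs, sq_abs, ← Complex.ofReal_pow]
  rw [Real.sq_sqrt (by positivity)]
  push_cast
  ring

lemma integral_integral_stdGaussian_add_smul {F : E → ℝ} (hF : Continuous F) {b : ℝ}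
    (hb : ∀ x, |F x| ≤ b) (s t : ℝ) (x : E) :
    ∫ z, ∫ w, F (x + t • z + s • w) ∂(stdGaussian E) ∂(stdGaussian E)
      = ∫ z, F (x + √(s ^ 2 + t ^ 2) • z) ∂(stdGaussian E) := by
  have h : ∀ r : ℝ, IsProbabilityMeasure ((stdGaussian E).map (r • ·)) := fun r ↦
    Measure.isProbabilityMeasure_map (by fun_prop)
  have h1 : ∫ z, F (x + √(s ^ 2 + t ^ 2) • z) ∂(stdGaussian E)
      = ∫ z, F (x + z) ∂((stdGaussian E).map (√(s ^ 2 + t ^ 2) • ·)) := by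
    rw [integral_map (by fun_prop) (by fun_prop)]
  rw [h1, add_comm (s ^ 2), ← stdGaussian_map_smul_conv, integral_conv]
  · rw [integral_map (by fun_prop)]
    · refine integral_congr_ae (.of_forall fun z ↦ ?_)
      simp only
      rw [integral_map (by fun_prop) (by fun_prop)]
      simp_rw [add_assoc]
    · have : Continuous fun z ↦ ∫ w, F (x + (z + w)) ∂((stdGaussian E).map (s • ·)) := by
        refine continuous_of_dominated (bound := fun _ ↦ b) (fun z ↦ by fun_prop)
          (fun z ↦ .of_forall fun w ↦ hb _) (integrable_const _) (.of_forall fun w ↦ by fun_prop)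
      exact this.aestronglyMeasurable
  · exact Integrable.of_bound (by fun_prop) b (.of_forall fun z ↦ hb _)

lemma integrable_norm_pow_stdGaussian (k : ℕ) (hk : k ≠ 0) :
    Integrable (fun z : E ↦ ‖z‖ ^ k) (stdGaussian E) := by
  have h := (IsGaussian.memLp_id (stdGaussian E) (k : ℝ≥0∞) (by simp)).integrable_norm_pow hk
  simpa using h

lemma integrable_inner_stdGaussian (u : E) : Integrable (fun z : E ↦ ⟪u, z⟫) (stdGaussian E) :=
  IsGaussian.integrable_id.const_inner u

lemma integral_inner_stdGaussian (u : E) : ∫ z, ⟪u, z⟫ ∂(stdGaussian E) = 0 :=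
  integral_strongDual_stdGaussian (innerSL ℝ u)

lemma integrable_inner_sq_stdGaussian (u : E) :
    Integrable (fun z : E ↦ ⟪u, z⟫ ^ 2) (stdGaussian E) := by
  refine ((integrable_norm_pow_stdGaussian (E := E) 2 two_ne_zero).const_mul (‖u‖ ^ 2)).mono'
    (by fun_prop) (.of_forall fun z ↦ ?_)
  rw [Real.norm_eq_abs, abs_pow, ← mul_pow]
  exact pow_le_pow_left₀ (abs_nonneg _) (abs_real_inner_le_norm u z) 2

lemma integral_inner_sq_stdGaussian (u : E) :
    ∫ z, ⟪u, z⟫ ^ 2 ∂(stdGaussian E) = ‖u‖ ^ 2 := by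
  have h := variance_dual_stdGaussian (innerSL ℝ u)
  rw [variance_of_integral_eq_zero (by fun_prop) (integral_strongDual_stdGaussian _)] at h
  simpa using h

lemma lintegral_exp_inner_stdGaussian (u : E) :
    ∫⁻ z, ENNReal.ofReal (Real.exp ⟪u, z⟫) ∂(stdGaussian E)
      = ENNReal.ofReal (Real.exp (‖u‖ ^ 2 / 2)) := by
  have hmap : (stdGaussian E).map (innerSL ℝ u) = gaussianReal 0 (‖u‖₊ ^ 2) := by
    rw [IsGaussian.map_eq_gaussianReal, variance_dual_stdGaussian,
      integral_strongDual_stdGaussian, innerSL_apply_norm]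
    congr 1
    ext
    simp
  have h1 : ∫⁻ z, ENNReal.ofReal (Real.exp ⟪u, z⟫) ∂(stdGaussian E)
      = ∫⁻ y, ENNReal.ofReal (Real.exp y) ∂(gaussianReal 0 (‖u‖₊ ^ 2)) := by
    rw [← hmap, lintegral_map (by fun_prop) (by fun_prop)]
    rfl
  have h2 := mgf_gaussianReal (p := gaussianReal 0 (‖u‖₊ ^ 2)) (X := id) (Measure.map_id) 1
  have h3 := integrable_exp_mul_gaussianReal (μ := 0) (v := ‖u‖₊ ^ 2) 1
  simp only [mgf, id, one_mul] at h2 h3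
  rw [h1, ← ofReal_integral_eq_lintegral_ofReal h3 (.of_forall fun y ↦ (Real.exp_pos _).le), h2]
  simp

end Gaussian

/-! ### Functions varying along a subspace, and Gaussian averages -/

lemma continuous_prod_rpow {X ι : Type*} [TopologicalSpace X] [Fintype ι] {θ : ι → ℝ}
    {F : ι → X → ℝ} (hc : ∀ j, Continuous (F j)) (hpos : ∀ j x, 0 < F j x) :
    Continuous fun x ↦ ∏ j, F j x ^ θ j :=
  continuous_finsetProd _ fun j _ ↦ (hc j).rpow_const fun x ↦ Or.inl (hpos j x).ne'

section Tame

variable {E : Type*} [NormedAddCommGroup E] [InnerProductSpace ℝ E]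

open scoped RealInnerProductSpace

/-- `F : E → ℝ` takes values in `[a, b]` and is of class `C^{1,1}` with constant `M`, with a
gradient field `g` that is everywhere tangent to the subspace `V`. The Taylor estimate is what
encodes that `g` is the gradient of `F`. For fixed constants this class of functions is stable
under translation and averaging. -/
structure IsTame (V : Submodule ℝ E) (a b M : ℝ) (F : E → ℝ) (g : E → V) : Prop where
  lower : ∀ x, a ≤ F x
  upper : ∀ x, F x ≤ b
  continuous : Continuous F
  continuous_grad : Continuous g
  lip : ∀ x h, |F (x + h) - F x| ≤ M * ‖h‖
  norm_grad_le : ∀ x, ‖g x‖ ≤ M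
  taylor : ∀ x h, |F (x + h) - F x - ⟪(g x : E), h⟫| ≤ M * ‖h‖ ^ 2

variable {V : Submodule ℝ E} {a b M : ℝ} {F : E → ℝ} {g : E → V}

lemma IsTame.abs_le (hF : IsTame V a b M F g) (ha : 0 ≤ a) (x : E) : |F x| ≤ b := by
  rw [abs_of_nonneg (ha.trans (hF.lower x))]
  exact hF.upper x

lemma IsTame.integrable_comp [SecondCountableTopology E] [MeasurableSpace E] [BorelSpace E]
    (hF : IsTame V a b M F g) (ha : 0 ≤ a) {μ : Measure E}
    [IsFiniteMeasure μ] {T : E → E} (hT : Continuous T) : Integrable (fun z ↦ F (T z)) μ :=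
  Integrable.of_bound (hF.continuous.comp hT).aestronglyMeasurable b
    (.of_forall fun _ ↦ hF.abs_le ha _)

variable [FiniteDimensional ℝ E] [MeasurableSpace E] [BorelSpace E]

lemma IsTame.average (hF : IsTame V a b M F g) (ha : 0 ≤ a) (μ : Measure E)
    [IsProbabilityMeasure μ] {T : E → E} (hT : Continuous T) :
    IsTame V a b M (fun x ↦ ∫ z, F (x + T z) ∂μ) (fun x ↦ ∫ z, g (x + T z) ∂μ) := by
  have hc := hF.continuous
  have hcg := hF.continuous_grad
  have hi : ∀ x, Integrable (fun z ↦ F (x + T z)) μ := fun x ↦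
    hF.integrable_comp ha (by fun_prop)
  have hgi : ∀ x, Integrable (fun z ↦ g (x + T z)) μ := fun x ↦
    Integrable.of_bound (Continuous.aestronglyMeasurable (by fun_prop)) M
      (.of_forall fun z ↦ hF.norm_grad_le _)
  refine ⟨fun x ↦ ?_, fun x ↦ ?_, ?_, ?_, fun x h ↦ ?_, fun x ↦ ?_, fun x h ↦ ?_⟩
  · simpa using integral_mono (μ := μ) (integrable_const a) (hi x) fun z ↦ hF.lower _
  · simpa using integral_mono (μ := μ) (hi x) (integrable_const b) fun z ↦ hF.upper _
  · exact continuous_of_dominated (bound := fun _ ↦ b)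
      (fun x ↦ Continuous.aestronglyMeasurable (by fun_prop))
      (fun x ↦ .of_forall fun z ↦ hF.abs_le ha _) (integrable_const _)
      (.of_forall fun z ↦ by fun_prop)
  · exact continuous_of_dominated (bound := fun _ ↦ M)
      (fun x ↦ Continuous.aestronglyMeasurable (by fun_prop))
      (fun x ↦ .of_forall fun z ↦ hF.norm_grad_le _) (integrable_const _)
      (.of_forall fun z ↦ by fun_prop)
  · rw [← Real.norm_eq_abs, ← integral_sub (hi _) (hi _)]
    refine (norm_integral_le_of_norm_le_const (C := M * ‖h‖) (.of_forall fun z ↦ ?_)).trans_eq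
      (by simp)
    rw [Real.norm_eq_abs, add_right_comm]
    exact hF.lip _ _
  · exact (norm_integral_le_of_norm_le_const (C := M)
      (.of_forall fun z ↦ hF.norm_grad_le _)).trans_eq (by simp)
  · have hin : ⟪((∫ z, g (x + T z) ∂μ : V) : E), h⟫ = ∫ z, ⟪(g (x + T z) : E), h⟫ ∂μ := by
      have := ((innerSL ℝ h).comp V.subtypeL).integral_comp_comm (hgi x)
      simpa [real_inner_comm] using this.symm
    have hii : Integrable (fun z ↦ ⟪(g (x + T z) : E), h⟫) μ :=
      Integrable.of_bound (Continuous.aestronglyMeasurable (by fun_prop)) (M * ‖h‖)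
        (.of_forall fun z ↦ (abs_real_inner_le_norm _ _).trans
          (mul_le_mul_of_nonneg_right (hF.norm_grad_le _) (norm_nonneg _)))
    rw [← Real.norm_eq_abs, hin, ← integral_sub (hi _) (hi _),
      ← integral_sub (by exact (hi _).sub (hi _)) hii]
    refine (norm_integral_le_of_norm_le_const (C := M * ‖h‖ ^ 2)
      (.of_forall fun z ↦ ?_)).trans_eq (by simp)
    rw [Real.norm_eq_abs, add_right_comm]
    exact hF.taylor _ _

variable {ι : Type*} [Fintype ι] {U : ι → Submodule ℝ E} {θ : ι → ℝ}

/-- The inequality for a Gaussian displacement of small variance `s ^ 2`, up to an error `O(s ^ 3)`.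
Expanding both sides to second order, the terms of order `s ^ 2` differ by half of the variance
of `∑ j, θ j * ⟪w j, z⟫` minus the weighted sum of the variances of `⟪w j, z⟫`, where `w j` is the
logarithmic gradient of `F j`; the hypothesis `hquad` says that this is not positive. -/
lemma exists_integral_prod_rpow_le_of_small_displacement
    (hθ : ∀ j, 0 ≤ θ j) (hquad : ∀ w : ∀ j, U j, ‖∑ j, θ j • (w j : E)‖ ^ 2 ≤ ∑ j, θ j * ‖w j‖ ^ 2)
    (ha : 0 < a) (hab : a ≤ b) (hM : 0 ≤ M) :
    ∃ K : ℝ, 0 ≤ K ∧ ∀ (F : ι → E → ℝ) (g : ∀ j, E → U j), (∀ j, IsTame (U j) a b M (F j) (g j)) →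
      ∀ s : ℝ, 0 ≤ s → s ≤ 1 → ∀ x,
      ∫ z, ∏ j, F j (x + s • z) ^ θ j ∂(stdGaussian E)
        ≤ ∏ j, (∫ z, F j (x + s • z) ∂(stdGaussian E)) ^ θ j + K * s ^ 3 := by
  have hb : 0 < b := ha.trans_le hab
  set c := M / a with hc
  have hc0 : 0 ≤ c := by positivity
  set R := b / a + 1 with hR
  have hR0 : 0 ≤ R := by positivity
  obtain ⟨K₀, hK₀, hexp⟩ := exists_prod_one_add_rpow_le hθ hR0 hc0
  set γ := stdGaussian E with hγ
  set m₂ := ∫ z, ‖z‖ ^ 2 ∂γ with hm₂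
  set m₃ := ∫ z, ‖z‖ ^ 3 ∂γ with hm₃
  have hm₂0 : 0 ≤ m₂ := integral_nonneg fun z ↦ by positivity
  have hm₃0 : 0 ≤ m₃ := integral_nonneg fun z ↦ by positivity
  set T := ∑ j, θ j with hT
  have hT0 : 0 ≤ T := Finset.sum_nonneg fun j _ ↦ hθ j
  set B := ∏ j, b ^ θ j with hB
  have hB0 : 0 ≤ B := by positivity
  refine ⟨B * (K₀ * m₃ + T * (b / a * (c * m₂) ^ 2)), by positivity, ?_⟩
  intro F g hF s hs hs1 x
  have hFpos : ∀ j y, 0 < F j y := fun j y ↦ ha.trans_le ((hF j).lower y)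
  have hFi : ∀ j, Integrable (fun z ↦ F j (x + s • z)) γ := fun j ↦
    (hF j).integrable_comp ha.le (by fun_prop)
  set H := ∏ j, F j x ^ θ j with hH
  have hH0 : 0 ≤ H := Finset.prod_nonneg fun j _ ↦ (Real.rpow_nonneg (hFpos j x).le _)
  have hHB : H ≤ B := Finset.prod_le_prod (fun j _ ↦ Real.rpow_nonneg (hFpos j x).le _)
    fun j _ ↦ Real.rpow_le_rpow (hFpos j x).le ((hF j).upper x) (hθ j)
  set r : ι → E → ℝ := fun j z ↦ F j (x + s • z) / F j x - 1 with hr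
  set w : ∀ j, U j := fun j ↦ (F j x)⁻¹ • g j x with hw
  set ℓ : ι → E → ℝ := fun j z ↦ s * ⟪(w j : E), z⟫ with hℓ
  have hr1 : ∀ j z, 1 + r j z = F j (x + s • z) / F j x := fun j z ↦ by simp [hr]
  have hrpos : ∀ j z, -1 < r j z := fun j z ↦ by
    have := div_pos (hFpos j (x + s • z)) (hFpos j x)
    simp only [hr]; linarith
  have hrR : ∀ j z, |r j z| ≤ R := fun j z ↦ by
    have h1 : F j (x + s • z) / F j x ≤ b / a :=
      div_le_div₀ hb.le ((hF j).upper _) ha ((hF j).lower x)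
    have h2 := hrpos j z
    have h3 : 0 ≤ b / a := by positivity
    rw [abs_le]
    constructor
    · linarith
    · simp only [hr]; linarith
  -- every estimate on `F j` becomes one on `r j` after division by `F j x ≥ a`
  have hdiv : ∀ j (u v : ℝ), |u| ≤ M * v → 0 ≤ v → |u / F j x| ≤ c * v := fun j u v h h0 ↦ by
    rw [abs_div, abs_of_pos (hFpos j x), hc, div_mul_eq_mul_div]
    exact div_le_div₀ (by positivity) h ha ((hF j).lower x)
  have hnorm : ∀ z : E, ‖s • z‖ = s * ‖z‖ := fun z ↦ by
    rw [norm_smul, Real.norm_of_nonneg hs]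
  have hrt : ∀ j z, |r j z| ≤ c * (s * ‖z‖) := fun j z ↦ by
    have h1 : r j z = (F j (x + s • z) - F j x) / F j x := by
      simp only [hr]; field_simp [(hFpos j x).ne']
    rw [h1, ← hnorm]
    exact hdiv j _ _ ((hF j).lip _ _) (norm_nonneg _)
  have hℓeq : ∀ j z, ℓ j z = ⟪(g j x : E), s • z⟫ / F j x := fun j z ↦ by
    simp only [hℓ, hw, Submodule.coe_smul, real_inner_smul_left, real_inner_smul_right]
    field_simp
  have hℓt : ∀ j z, |ℓ j z| ≤ c * (s * ‖z‖) := fun j z ↦ by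
    rw [hℓeq, ← hnorm]
    refine hdiv j _ _ ((abs_real_inner_le_norm _ _).trans ?_) (norm_nonneg _)
    exact mul_le_mul_of_nonneg_right ((hF j).norm_grad_le x) (norm_nonneg _)
  have hrℓ : ∀ j z, |r j z - ℓ j z| ≤ c * (s * ‖z‖) ^ 2 := fun j z ↦ by
    have h1 : r j z - ℓ j z = (F j (x + s • z) - F j x - ⟪(g j x : E), s • z⟫) / F j x := by
      rw [hℓeq]; simp only [hr]; field_simp [(hFpos j x).ne']
    rw [h1, ← hnorm]
    exact hdiv j _ _ ((hF j).taylor _ _) (by positivity)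
  have hri : ∀ j, Integrable (r j) γ := fun j ↦ ((hFi j).div_const _).sub (integrable_const 1)
  have hℓi : ∀ j, Integrable (ℓ j) γ := fun j ↦ (integrable_inner_stdGaussian _).const_mul s
  have hℓ0 : ∀ j, ∫ z, ℓ j z ∂γ = 0 := fun j ↦ by
    simp only [hℓ]
    rw [integral_const_mul, hγ, integral_inner_stdGaussian, mul_zero]
  -- the mean of each relative increment is of second order
  set m : ι → ℝ := fun j ↦ ∫ z, r j z ∂γ with hm
  have hmle : ∀ j, |m j| ≤ c * m₂ * s ^ 2 := fun j ↦ by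
    have h1 : m j = ∫ z, (r j z - ℓ j z) ∂γ := by
      rw [integral_sub (hri j) (hℓi j), hℓ0, sub_zero]
    have h2 : ∫ z, c * s ^ 2 * ‖z‖ ^ 2 ∂γ = c * m₂ * s ^ 2 := by
      rw [integral_const_mul, ← hm₂]; ring
    rw [h1, ← h2, ← Real.norm_eq_abs]
    refine norm_integral_le_of_norm_le
      ((integrable_norm_pow_stdGaussian 2 two_ne_zero).const_mul _) (.of_forall fun z ↦ ?_)
    exact (hrℓ j z).trans_eq (by ring)
  have hm1 : ∀ j, 1 + m j = (∫ z, F j (x + s • z) ∂γ) / F j x := fun j ↦ by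
    simp only [hm, hr]
    rw [integral_sub ((hFi j).div_const _) (integrable_const 1), integral_div]
    simp
  have hav := fun j ↦ (hF j).average ha.le γ (T := fun z ↦ s • z) (by fun_prop)
  have hIpos : ∀ j, 0 < ∫ z, F j (x + s • z) ∂γ := fun j ↦ ha.trans_le ((hav j).lower x)
  -- upper bound for the left-hand side
  have hquad_int : ∀ u : E, Integrable (fun z ↦ (s * ⟪u, z⟫) ^ 2) γ := fun u ↦ by
    simp_rw [mul_pow]
    exact (integrable_inner_sq_stdGaussian u).const_mul _
  have hlin : ∀ z, ∑ j, θ j * ℓ j z = s * ⟪∑ j, θ j • (w j : E), z⟫ := fun z ↦ by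
    rw [sum_inner, Finset.mul_sum]
    refine Finset.sum_congr rfl fun j _ ↦ ?_
    simp only [hℓ, real_inner_smul_left]
    ring
  have hint₁ : Integrable (fun z ↦ ∑ j, θ j * r j z) γ :=
    integrable_finsetSum _ fun j _ ↦ (hri j).const_mul _
  have hint₂ : Integrable (fun z ↦ (∑ j, θ j * ℓ j z) ^ 2) γ := by
    simp_rw [hlin]; exact hquad_int _
  have hint₃ : Integrable (fun z ↦ ∑ j, θ j * ℓ j z ^ 2) γ :=
    integrable_finsetSum _ fun j _ ↦ (hquad_int _).const_mul _
  have hint₄ : Integrable (fun z ↦ K₀ * (s * ‖z‖) ^ 3) γ := by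
    simp_rw [mul_pow]
    exact ((integrable_norm_pow_stdGaussian 3 three_ne_zero).const_mul _).const_mul _
  have hquad_le : ∫ z, ((∑ j, θ j * ℓ j z) ^ 2 - ∑ j, θ j * ℓ j z ^ 2) / 2 ∂γ ≤ 0 := by
    rw [integral_div, integral_sub hint₂ hint₃, integral_finsetSum _ fun j _ ↦
      (hquad_int _).const_mul _]
    have h0 : ∀ u : E, ∫ z, (s * ⟪u, z⟫) ^ 2 ∂γ = s ^ 2 * ‖u‖ ^ 2 := fun u ↦ by
      simp_rw [mul_pow, integral_const_mul, hγ, integral_inner_sq_stdGaussian]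
    simp_rw [hlin, integral_const_mul, h0]
    have h1 : ∑ j, θ j * (s ^ 2 * ‖(w j : E)‖ ^ 2) = s ^ 2 * ∑ j, θ j * ‖w j‖ ^ 2 := by
      rw [Finset.mul_sum]
      exact Finset.sum_congr rfl fun j _ ↦ by rw [Submodule.coe_norm]; ring
    rw [h1]
    have h2 := mul_le_mul_of_nonneg_left (hquad w) (sq_nonneg s)
    linarith
  have hfact : ∀ z, ∏ j, F j (x + s • z) ^ θ j = H * ∏ j, (1 + r j z) ^ θ j := fun z ↦ by
    rw [hH, ← Finset.prod_mul_distrib]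
    refine Finset.prod_congr rfl fun j _ ↦ ?_
    rw [hr1, ← Real.mul_rpow (hFpos j x).le (div_pos (hFpos _ _) (hFpos _ _)).le,
      mul_div_cancel₀ _ (hFpos j x).ne']
  have hupper : ∫ z, ∏ j, (1 + r j z) ^ θ j ∂γ ≤ 1 + ∑ j, θ j * m j + K₀ * m₃ * s ^ 3 := by
    have hprodpos : ∀ z, 0 ≤ ∏ j, (1 + r j z) ^ θ j := fun z ↦
      Finset.prod_nonneg fun j _ ↦ Real.rpow_nonneg (by linarith [hrpos j z]) _
    have hle := integral_mono_of_nonneg (μ := γ) (.of_forall hprodpos)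
      ((((integrable_const 1).add hint₁).add ((hint₂.sub hint₃).div_const 2)).add hint₄)
      (.of_forall fun z ↦ hexp (fun j ↦ r j z) (fun j ↦ ℓ j z) (s * ‖z‖) (by positivity)
        (fun j ↦ hrpos j z) (fun j ↦ hrR j z) (fun j ↦ hrt j z) (fun j ↦ hℓt j z)
        (fun j ↦ hrℓ j z))
    refine hle.trans ?_
    have e1 := integral_add (((integrable_const (μ := γ) (1 : ℝ)).add hint₁).add
      ((hint₂.sub hint₃).div_const 2)) hint₄
    have e2 := integral_add ((integrable_const (μ := γ) (1 : ℝ)).add hint₁)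
      ((hint₂.sub hint₃).div_const 2)
    have e3 := integral_add (integrable_const (μ := γ) (1 : ℝ)) hint₁
    have e4 : ∫ z, K₀ * (s * ‖z‖) ^ 3 ∂γ = K₀ * m₃ * s ^ 3 := by
      simp_rw [mul_pow, integral_const_mul, ← hm₃]; ring
    have e5 : ∫ z, ∑ j, θ j * r j z ∂γ = ∑ j, θ j * m j := by
      rw [integral_finsetSum _ fun j _ ↦ (hri j).const_mul _]
      simp_rw [integral_const_mul, hm]
    have e6 : ∫ _, (1 : ℝ) ∂γ = 1 := by simp
    simp only [Pi.add_apply, Pi.sub_apply] at e1 e2 e3 ⊢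
    rw [e1, e2, e3, e4, e5, e6]
    linarith
  -- lower bound for the right-hand side
  have hlower : 1 + ∑ j, θ j * m j - T * (b / a * (c * m₂) ^ 2) * s ^ 3
      ≤ ∏ j, (1 + m j) ^ θ j := by
    refine le_trans ?_ (one_add_sum_sub_le_prod_rpow hθ (D := b / a) (m := m) (fun j ↦ ?_)
      fun j ↦ ?_)
    · have h1 : ∀ j, b / a * m j ^ 2 ≤ b / a * (c * m₂) ^ 2 * s ^ 3 := fun j ↦ by
        have h2 : m j ^ 2 ≤ (c * m₂ * s ^ 2) ^ 2 :=
          sq_le_sq' (abs_le.1 (hmle j)).1 (abs_le.1 (hmle j)).2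
        have h3 : s ^ 4 ≤ s ^ 3 := pow_le_pow_of_le_one hs hs1 (by norm_num)
        have h4 : m j ^ 2 ≤ (c * m₂) ^ 2 * s ^ 3 := h2.trans (by
          calc (c * m₂ * s ^ 2) ^ 2 = (c * m₂) ^ 2 * s ^ 4 := by ring
            _ ≤ _ := mul_le_mul_of_nonneg_left h3 (by positivity))
        rw [mul_assoc]
        exact mul_le_mul_of_nonneg_left h4 (by positivity)
      have h5 : ∑ j, θ j * (m j - b / a * (c * m₂) ^ 2 * s ^ 3)
          ≤ ∑ j, θ j * (m j - b / a * m j ^ 2) :=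
        Finset.sum_le_sum fun j _ ↦ mul_le_mul_of_nonneg_left (by linarith [h1 j]) (hθ j)
      refine le_trans (le_of_eq ?_) (add_le_add_right h5 1)
      simp_rw [mul_sub, Finset.sum_sub_distrib, ← Finset.sum_mul, ← hT]
      ring
    · have := div_pos (hIpos j) (hFpos j x)
      rw [← hm1] at this
      linarith
    · rw [hm1, div_mul_div_comm, one_le_div (by have := hFpos j x; positivity), mul_comm (F j x)]
      exact mul_le_mul ((hav j).lower x) ((hF j).upper x) (hFpos j x).le (hIpos j).le
  have hfact' : ∏ j, (∫ z, F j (x + s • z) ∂γ) ^ θ j = H * ∏ j, (1 + m j) ^ θ j := by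
    rw [hH, ← Finset.prod_mul_distrib]
    refine Finset.prod_congr rfl fun j _ ↦ ?_
    rw [hm1, ← Real.mul_rpow (hFpos j x).le (div_pos (hIpos j) (hFpos _ _)).le,
      mul_div_cancel₀ _ (hFpos j x).ne']
  simp_rw [hfact, integral_const_mul]
  rw [hfact']
  set err := K₀ * m₃ + T * (b / a * (c * m₂) ^ 2) with herr
  have herr0 : 0 ≤ err * s ^ 3 := by positivity
  calc H * ∫ z, ∏ j, (1 + r j z) ^ θ j ∂γ ≤ H * (∏ j, (1 + m j) ^ θ j + err * s ^ 3) := by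
        refine mul_le_mul_of_nonneg_left ?_ hH0
        rw [herr]; linarith
    _ = H * ∏ j, (1 + m j) ^ θ j + H * (err * s ^ 3) := by ring
    _ ≤ H * ∏ j, (1 + m j) ^ θ j + B * (err * s ^ 3) := by
        have := mul_le_mul_of_nonneg_right hHB herr0
        linarith
    _ = _ := by ring

/-- Iterating the inequality for small displacements along `k` independent Gaussian increments. -/
lemma integral_prod_rpow_le_add_of_displacement (hθ : ∀ j, 0 ≤ θ j) (ha : 0 < a) {K : ℝ}
    {s : ℝ} (hs : 0 ≤ s)
    (hstep : ∀ (F : ι → E → ℝ) (g : ∀ j, E → U j), (∀ j, IsTame (U j) a b M (F j) (g j)) →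
      ∀ x, ∫ z, ∏ j, F j (x + s • z) ^ θ j ∂(stdGaussian E)
        ≤ ∏ j, (∫ z, F j (x + s • z) ∂(stdGaussian E)) ^ θ j + K * s ^ 3)
    {F : ι → E → ℝ} {g : ∀ j, E → U j} (hF : ∀ j, IsTame (U j) a b M (F j) (g j)) (k : ℕ) (x : E) :
    ∫ z, ∏ j, F j (x + (√k * s) • z) ^ θ j ∂(stdGaussian E)
      ≤ ∏ j, (∫ z, F j (x + (√k * s) • z) ∂(stdGaussian E)) ^ θ j + k * (K * s ^ 3) := by
  induction k generalizing x with
  | zero => simp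
  | succ k ih =>
    have hFpos : ∀ j y, 0 < F j y := fun j y ↦ ha.trans_le ((hF j).lower y)
    have hFc : ∀ j, Continuous (F j) := fun j ↦ (hF j).continuous
    have hGc : Continuous fun x ↦ ∏ j, F j x ^ θ j := continuous_prod_rpow hFc hFpos
    have hGb : ∀ x, |∏ j, F j x ^ θ j| ≤ ∏ j, b ^ θ j := fun x ↦ by
      rw [Finset.abs_prod]
      refine Finset.prod_le_prod (fun j _ ↦ abs_nonneg _) fun j _ ↦ ?_
      rw [abs_of_nonneg (Real.rpow_nonneg (hFpos j x).le _)]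
      exact Real.rpow_le_rpow (hFpos j x).le ((hF j).upper x) (hθ j)
    -- variances of independent increments add up: `k * s ^ 2 + s ^ 2 = (k + 1) * s ^ 2`
    have hsq : √((√k * s) ^ 2 + s ^ 2) = √((k + 1 : ℕ) : ℝ) * s := by
      rw [mul_pow, Real.sq_sqrt (by positivity), ← add_one_mul, Real.sqrt_mul (by positivity),
        Real.sqrt_sq hs]
      push_cast
      rfl
    have hav := fun j ↦ (hF j).average ha.le (stdGaussian E) (T := fun z ↦ (√k * s) • z)
      (by fun_prop)
    have hGavc : Continuous fun y ↦ ∏ j, (∫ w, F j (y + (√k * s) • w) ∂(stdGaussian E)) ^ θ j :=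
      continuous_prod_rpow (fun j ↦ (hav j).continuous)
        fun j y ↦ ha.trans_le ((hav j).lower y)
    have hint : Integrable
        (fun z ↦ ∏ j, (∫ w, F j (x + s • z + (√k * s) • w) ∂(stdGaussian E)) ^ θ j)
        (stdGaussian E) := by
      refine Integrable.of_bound
        (hGavc.comp (continuous_const.add (continuous_const_smul s))).aestronglyMeasurable
        (∏ j, b ^ θ j) (.of_forall fun z ↦ ?_)
      rw [Real.norm_eq_abs, Finset.abs_prod]
      refine Finset.prod_le_prod (fun j _ ↦ abs_nonneg _) fun j _ ↦ ?_
      have h0 := ha.le.trans ((hav j).lower (x + s • z))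
      rw [abs_of_nonneg (Real.rpow_nonneg h0 _)]
      exact Real.rpow_le_rpow h0 ((hav j).upper _) (hθ j)
    rw [← hsq, ← integral_integral_stdGaussian_add_smul hGc hGb]
    have hconv : ∀ j, ∫ z, F j (x + √((√k * s) ^ 2 + s ^ 2) • z) ∂(stdGaussian E)
        = ∫ z, ∫ w, F j (x + s • z + (√k * s) • w) ∂(stdGaussian E) ∂(stdGaussian E) := fun j ↦
      (integral_integral_stdGaussian_add_smul (hFc j) ((hF j).abs_le ha.le) _ _ x).symm
    simp_rw [hconv]
    calc _ ≤ ∫ z, (∏ j, (∫ w, F j (x + s • z + (√k * s) • w) ∂(stdGaussian E)) ^ θ j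
            + k * (K * s ^ 3)) ∂(stdGaussian E) := by
          refine integral_mono_of_nonneg (.of_forall fun z ↦ integral_nonneg fun w ↦ ?_)
            (hint.add (integrable_const _)) (.of_forall fun z ↦ ih (x + s • z))
          exact Finset.prod_nonneg fun j _ ↦ Real.rpow_nonneg (hFpos j _).le _
      _ = (∫ z, ∏ j, (∫ w, F j (x + s • z + (√k * s) • w) ∂(stdGaussian E)) ^ θ j
            ∂(stdGaussian E)) + k * (K * s ^ 3) := by
          rw [integral_add hint (integrable_const _)]; simp
      _ ≤ _ := by
          have := hstep _ _ hav x
          push_cast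
          linarith

/-- The inequality for tame functions: it follows by letting the number `m` of independent
increments, each of standard deviation `1 / √m`, tend to infinity. -/
lemma IsTame.integral_prod_rpow_le
    (hθ : ∀ j, 0 ≤ θ j) (hquad : ∀ w : ∀ j, U j, ‖∑ j, θ j • (w j : E)‖ ^ 2 ≤ ∑ j, θ j * ‖w j‖ ^ 2)
    (ha : 0 < a) (hab : a ≤ b) (hM : 0 ≤ M) {F : ι → E → ℝ} {g : ∀ j, E → U j}
    (hF : ∀ j, IsTame (U j) a b M (F j) (g j)) :
    ∫ z, ∏ j, F j z ^ θ j ∂(stdGaussian E) ≤ ∏ j, (∫ z, F j z ∂(stdGaussian E)) ^ θ j := by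
  obtain ⟨K, -, hK⟩ := exists_integral_prod_rpow_le_of_small_displacement hθ hquad ha hab hM
  have hlim : Filter.Tendsto (fun m : ℕ ↦ ∏ j, (∫ z, F j z ∂(stdGaussian E)) ^ θ j
      + K * (√((m : ℝ) + 1))⁻¹) Filter.atTop
      (nhds (∏ j, (∫ z, F j z ∂(stdGaussian E)) ^ θ j + K * 0)) := by
    refine tendsto_const_nhds.add (Filter.Tendsto.const_mul _ ?_)
    refine Filter.Tendsto.inv_tendsto_atTop (Real.tendsto_sqrt_atTop.comp ?_)
    exact Filter.tendsto_atTop_add_const_right _ _ tendsto_natCast_atTop_atTop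
  rw [mul_zero, add_zero] at hlim
  refine ge_of_tendsto' hlim fun m ↦ ?_
  set q := √((m : ℝ) + 1) with hq
  have hq1 : 1 ≤ q := Real.one_le_sqrt.2 (by linarith [(Nat.cast_nonneg m : (0 : ℝ) ≤ m)])
  have hq0 : q ≠ 0 := by positivity
  have hq2 : (m : ℝ) + 1 = q ^ 2 := (Real.sq_sqrt (by positivity)).symm
  have h := integral_prod_rpow_le_add_of_displacement hθ ha (s := q⁻¹) (K := K) (by positivity)
    (fun F g hF x ↦ hK F g hF q⁻¹ (by positivity) (inv_le_one_of_one_le₀ hq1) x) hF (m + 1) 0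
  push_cast at h
  rw [← hq, mul_inv_cancel₀ hq0, hq2] at h
  simp only [zero_add, one_smul] at h
  refine h.trans_eq ?_
  congr 1
  field_simp

end Tame

/-! ### From smooth functions to measurable functions -/

section Approximation

variable {E : Type*} [NormedAddCommGroup E] [InnerProductSpace ℝ E]

open scoped RealInnerProductSpace ContDiff

open Filter Topology

lemma IsTame.mono {V : Submodule ℝ E} {a b b' M M' : ℝ} {F : E → ℝ} {g : E → V}
    (hF : IsTame V a b M F g) (hb : b ≤ b') (hM : M ≤ M') : IsTame V a b' M' F g where
  lower := hF.lower
  upper x := (hF.upper x).trans hb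
  continuous := hF.continuous
  continuous_grad := hF.continuous_grad
  lip x h := (hF.lip x h).trans (mul_le_mul_of_nonneg_right hM (norm_nonneg _))
  norm_grad_le x := (hF.norm_grad_le x).trans hM
  taylor x h := (hF.taylor x h).trans (mul_le_mul_of_nonneg_right hM (by positivity))

/-- First-order Taylor estimate, uniform in the base point, for a smooth compactly supported
function. -/
lemma exists_abs_sub_sub_fderiv_le {W : Type*} [NormedAddCommGroup W] [NormedSpace ℝ W]
    {ψ : W → ℝ} (hψ : ContDiff ℝ ∞ ψ) (hc : HasCompactSupport ψ) :
    ∃ K : ℝ≥0, ∀ y k : W, |ψ (y + k) - ψ y - fderiv ℝ ψ y k| ≤ K * ‖k‖ ^ 2 := by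
  obtain ⟨K, hK⟩ := (contDiff_infty_iff_fderiv.1 hψ).2.lipschitzWith_of_hasCompactSupport
    (hc.fderiv ℝ) (by simp)
  refine ⟨K, fun y k ↦ ?_⟩
  have hmv := (convex_closedBall y ‖k‖).norm_image_sub_le_of_norm_fderiv_le' (𝕜 := ℝ)
    (f := ψ) (φ := fderiv ℝ ψ y) (C := K * ‖k‖)
    (fun z _ ↦ hψ.differentiable (by simp) z)
    (fun z hz ↦ (hK.norm_sub_le z y).trans
      (mul_le_mul_of_nonneg_left (mem_closedBall_iff_norm.1 hz) K.2))
    (Metric.mem_closedBall_self (norm_nonneg k)) (y := y + k) (by simp)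
  rw [add_sub_cancel_left] at hmv
  exact hmv.trans_eq (by ring)

variable [FiniteDimensional ℝ E]

/-- A smooth compactly supported function on a subspace, composed with the orthogonal projection
and shifted by a constant, is tame. -/
lemma exists_isTame_comp_orthogonalProjectionOnto (V : Submodule ℝ E) {ψ : V → ℝ}
    (hψ : ContDiff ℝ ∞ ψ) (hc : HasCompactSupport ψ) (h0 : ∀ y, 0 ≤ ψ y) (δ : ℝ) :
    ∃ (B M : ℝ) (g : E → V), 0 ≤ B ∧ 0 ≤ M ∧
      IsTame V δ (B + δ) M (fun x ↦ ψ (V.orthogonalProjectionOnto x) + δ) g := by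
  obtain ⟨B, hB⟩ := hc.exists_bound_of_continuous hψ.continuous
  obtain ⟨K₁, hK₁⟩ := hψ.lipschitzWith_of_hasCompactSupport hc (by simp)
  obtain ⟨K₂, hK₂⟩ := exists_abs_sub_sub_fderiv_le hψ hc
  have hP : ∀ h, ‖V.orthogonalProjectionOnto h‖ ≤ ‖h‖ := V.norm_orthogonalProjectionOnto_apply_le
  refine ⟨B, max K₁ K₂, fun x ↦ (InnerProductSpace.toDual ℝ V).symm
    (fderiv ℝ ψ (V.orthogonalProjectionOnto x)), (norm_nonneg _).trans (hB 0),
    le_max_of_le_left K₁.2, ?_⟩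
  refine ⟨fun x ↦ le_add_of_nonneg_left (h0 _), fun x ↦ ?_, ?_, ?_, fun x h ↦ ?_, fun x ↦ ?_,
    fun x h ↦ ?_⟩
  · exact add_le_add_left ((le_abs_self _).trans (hB _)) δ
  · exact (hψ.continuous.comp V.orthogonalProjectionOnto.continuous).add continuous_const
  · exact (InnerProductSpace.toDual ℝ V).symm.continuous.comp
      ((hψ.continuous_fderiv (by simp)).comp V.orthogonalProjectionOnto.continuous)
  · rw [map_add, add_sub_add_right_eq_sub]
    refine (hK₁.norm_sub_le _ _).trans ?_
    rw [add_sub_cancel_left]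
    exact mul_le_mul (le_max_left _ _) (hP h) (norm_nonneg _) (le_max_of_le_left K₁.2)
  · rw [LinearIsometryEquiv.norm_map]
    exact (norm_fderiv_le_of_lipschitz ℝ hK₁).trans (le_max_left _ _)
  · rw [map_add, add_sub_add_right_eq_sub,
      ← Submodule.inner_orthogonalProjectionOnto_eq_of_mem_left,
      InnerProductSpace.toDual_symm_apply]
    refine (hK₂ _ _).trans ?_
    exact mul_le_mul (le_max_right _ _) (pow_le_pow_left₀ (norm_nonneg _) (hP h) 2)
      (sq_nonneg _) (le_max_of_le_left K₁.2)

variable [MeasurableSpace E] [BorelSpace E] {ι : Type*} [Fintype ι] {U : ι → Submodule ℝ E}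
  {θ : ι → ℝ}

/-- The inequality for `F j = φ j ^ 2 + δ`, which is smooth, bounded, and bounded away from `0`. -/
lemma lintegral_prod_rpow_le_of_contDiff (hθ : ∀ j, 0 ≤ θ j)
    (hquad : ∀ w : ∀ j, U j, ‖∑ j, θ j • (w j : E)‖ ^ 2 ≤ ∑ j, θ j * ‖w j‖ ^ 2)
    {φ : ∀ j, U j → ℝ} (hφ : ∀ j, ContDiff ℝ ∞ (φ j)) (hc : ∀ j, HasCompactSupport (φ j))
    {δ : ℝ} (hδ : 0 < δ) :
    ∫⁻ x, ∏ j, (‖φ j ((U j).orthogonalProjectionOnto x)‖ₑ ^ 2 + ENNReal.ofReal δ) ^ θ j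
        ∂(stdGaussian E)
      ≤ ∏ j, (∫⁻ y, (‖φ j y‖ₑ ^ 2 + ENNReal.ofReal δ) ∂(stdGaussian (U j))) ^ θ j := by
  choose B M g hB hM htame using fun j ↦ exists_isTame_comp_orthogonalProjectionOnto (U j)
    ((hφ j).pow 2) ((hc j).comp_left (g := fun t : ℝ ↦ t ^ 2) (by simp)) (fun y ↦ sq_nonneg _) δ
  have htame' : ∀ j, IsTame (U j) δ (∑ i, B i + δ) (∑ i, M i)
      (fun x ↦ φ j ((U j).orthogonalProjectionOnto x) ^ 2 + δ) (g j) := fun j ↦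
    (htame j).mono (add_le_add_left (Finset.single_le_sum (fun i _ ↦ hB i) (Finset.mem_univ j)) δ)
      (Finset.single_le_sum (fun i _ ↦ hM i) (Finset.mem_univ j))
  have hpos : ∀ j x, 0 < φ j ((U j).orthogonalProjectionOnto x) ^ 2 + δ := fun j x ↦
    hδ.trans_le ((htame' j).lower x)
  have hmain := IsTame.integral_prod_rpow_le hθ hquad hδ
    (by linarith [Finset.sum_nonneg fun i (_ : i ∈ Finset.univ) ↦ hB i])
    (Finset.sum_nonneg fun i _ ↦ hM i) htame'
  have hconv : ∀ t : ℝ, ‖t‖ₑ ^ 2 + ENNReal.ofReal δ = ENNReal.ofReal (t ^ 2 + δ) := fun t ↦ by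
    rw [ENNReal.ofReal_add (sq_nonneg _) hδ.le, Real.enorm_eq_ofReal_abs,
      ← ENNReal.ofReal_pow (abs_nonneg _), sq_abs]
  simp_rw [hconv]
  have hL : ∀ x, ∏ j, ENNReal.ofReal (φ j ((U j).orthogonalProjectionOnto x) ^ 2 + δ) ^ θ j
      = ENNReal.ofReal (∏ j, (φ j ((U j).orthogonalProjectionOnto x) ^ 2 + δ) ^ θ j) := fun x ↦ by
    rw [ENNReal.ofReal_prod_of_nonneg fun j _ ↦ Real.rpow_nonneg (hpos j x).le _]
    exact Finset.prod_congr rfl fun j _ ↦ ENNReal.ofReal_rpow_of_nonneg (hpos j x).le (hθ j)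
  have hRj : ∀ j, ∫⁻ y, ENNReal.ofReal (φ j y ^ 2 + δ) ∂(stdGaussian (U j))
      = ENNReal.ofReal (∫ x, (φ j ((U j).orthogonalProjectionOnto x) ^ 2 + δ)
          ∂(stdGaussian E)) := fun j ↦ by
    have := (hφ j).continuous
    rw [← stdGaussian_map_orthogonalProjectionOnto (U j),
      lintegral_map (by fun_prop) (by fun_prop)]
    exact (ofReal_integral_eq_lintegral_ofReal ((htame' j).integrable_comp hδ.le continuous_id)
      (.of_forall fun x ↦ (hpos j x).le)).symm
  have hInn : ∀ j, 0 ≤ ∫ x, (φ j ((U j).orthogonalProjectionOnto x) ^ 2 + δ) ∂(stdGaussian E) :=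
    fun j ↦ integral_nonneg fun x ↦ (hpos j x).le
  simp_rw [hL, hRj]
  rw [← ofReal_integral_eq_lintegral_ofReal]
  · refine (ENNReal.ofReal_le_ofReal hmain).trans_eq ?_
    rw [ENNReal.ofReal_prod_of_nonneg fun j _ ↦ Real.rpow_nonneg (hInn j) _]
    exact Finset.prod_congr rfl fun j _ ↦ (ENNReal.ofReal_rpow_of_nonneg (hInn j) (hθ j)).symm
  · refine Integrable.of_bound (continuous_prod_rpow (fun j ↦ (htame' j).continuous)
      hpos).aestronglyMeasurable (∏ j, (∑ i, B i + δ) ^ θ j) (.of_forall fun x ↦ ?_)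
    rw [Real.norm_of_nonneg (Finset.prod_nonneg fun j _ ↦ Real.rpow_nonneg (hpos j x).le _)]
    exact Finset.prod_le_prod (fun j _ ↦ Real.rpow_nonneg (hpos j x).le _)
      fun j _ ↦ Real.rpow_le_rpow (hpos j x).le ((htame' j).upper x) (hθ j)
  · exact .of_forall fun x ↦ Finset.prod_nonneg fun j _ ↦ Real.rpow_nonneg (hpos j x).le _

end Approximation

section Measurable

open scoped ContDiff

open Filter Topology

/-- Smooth compactly supported functions approximate a square-integrable function almost everywhere
and, at the same time, in energy. -/
lemma exists_contDiff_seq_tendsto_ae_of_memLp_two {W : Type*} [NormedAddCommGroup W]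
    [NormedSpace ℝ W] [FiniteDimensional ℝ W] [MeasurableSpace W] [BorelSpace W] {μ : Measure W}
    [IsFiniteMeasure μ] {u : W → ℝ} (hu : MemLp u 2 μ) :
    ∃ φ : ℕ → W → ℝ, (∀ i, ContDiff ℝ ∞ (φ i)) ∧ (∀ i, HasCompactSupport (φ i)) ∧
      (∀ᵐ x ∂μ, Tendsto (fun i ↦ φ i x) atTop (𝓝 (u x))) ∧
      ∀ i, ∫⁻ x, ‖φ i x‖ₑ ^ 2 ∂μ ≤ (eLpNorm u 2 μ + ENNReal.ofReal (1 / ((i : ℝ) + 1))) ^ 2 := by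
  choose φ hφc hφ hφu using fun i : ℕ ↦ hu.exist_eLpNorm_sub_le (by simp) (by norm_num)
    (Nat.one_div_pos_of_nat (α := ℝ) (n := i))
  have hmeas : ∀ i, AEStronglyMeasurable (φ i) μ := fun i ↦ (hφ i).continuous.aestronglyMeasurable
  have hφu' : ∀ i, eLpNorm (φ i - u) 2 μ ≤ ENNReal.ofReal (1 / ((i : ℝ) + 1)) := fun i ↦ by
    rw [eLpNorm_sub_comm]; exact hφu i
  have hε : Tendsto (fun i : ℕ ↦ ENNReal.ofReal (1 / ((i : ℝ) + 1))) atTop (𝓝 0) := by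
    simpa using ENNReal.tendsto_ofReal tendsto_one_div_add_atTop_nhds_zero_nat
  obtain ⟨ns, hns, hae⟩ := (tendstoInMeasure_of_tendsto_eLpNorm two_ne_zero hmeas hu.1
    (tendsto_of_tendsto_of_tendsto_of_le_of_le tendsto_const_nhds hε (fun _ ↦ zero_le)
      hφu')).exists_seq_tendsto_ae
  refine ⟨fun i ↦ φ (ns i), fun i ↦ hφ _, fun i ↦ hφc _, hae, fun i ↦ ?_⟩
  have h1 : ∫⁻ x, ‖φ (ns i) x‖ₑ ^ 2 ∂μ = eLpNorm (φ (ns i)) 2 μ ^ 2 := by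
    have := eLpNorm_nnreal_pow_eq_lintegral (μ := μ) (f := φ (ns i)) (p := 2) two_ne_zero
    simpa using this.symm
  rw [h1]
  gcongr
  calc eLpNorm (φ (ns i)) 2 μ = eLpNorm (u + (φ (ns i) - u)) 2 μ := by simp
    _ ≤ eLpNorm u 2 μ + eLpNorm (φ (ns i) - u) 2 μ :=
      eLpNorm_add_le hu.1 ((hmeas _).sub hu.1) (by norm_num)
    _ ≤ eLpNorm u 2 μ + ENNReal.ofReal (1 / ((i : ℝ) + 1)) := by
      gcongr
      refine (hφu' _).trans (ENNReal.ofReal_le_ofReal ?_)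
      exact Nat.one_div_le_one_div (hns.id_le i)

variable {E : Type*} [NormedAddCommGroup E] [InnerProductSpace ℝ E]
  [FiniteDimensional ℝ E] [MeasurableSpace E] [BorelSpace E] {ι : Type*} [Fintype ι]
  {U : ι → Submodule ℝ E} {θ : ι → ℝ}

/-- The inequality for `F j = u j ^ 2`: approximate each `u j` by smooth compactly supported
functions and apply Fatou's lemma. -/
lemma lintegral_prod_rpow_le_of_memLp_two (hθ : ∀ j, 0 ≤ θ j)
    (hquad : ∀ w : ∀ j, U j, ‖∑ j, θ j • (w j : E)‖ ^ 2 ≤ ∑ j, θ j * ‖w j‖ ^ 2)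
    {u : ∀ j, U j → ℝ} (hu : ∀ j, MemLp (u j) 2 (stdGaussian (U j))) :
    ∫⁻ x, ∏ j, (‖u j ((U j).orthogonalProjectionOnto x)‖ₑ ^ 2) ^ θ j ∂(stdGaussian E)
      ≤ ∏ j, (∫⁻ y, ‖u j y‖ₑ ^ 2 ∂(stdGaussian (U j))) ^ θ j := by
  choose φ hφ hφc hae hle using fun j ↦ exists_contDiff_seq_tendsto_ae_of_memLp_two (hu j)
  have hφm : ∀ j i, Measurable (φ j i) := fun j i ↦ (hφ j i).continuous.measurable
  set δ : ℕ → ℝ := fun i ↦ 1 / ((i : ℝ) + 1) with hδ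
  have hδ0 : ∀ i, 0 < δ i := fun i ↦ Nat.one_div_pos_of_nat
  have hδlim : Tendsto (fun i ↦ ENNReal.ofReal (δ i)) atTop (𝓝 0) := by
    simpa [hδ] using ENNReal.tendsto_ofReal tendsto_one_div_add_atTop_nhds_zero_nat
  set G : ℕ → E → ℝ≥0∞ := fun i x ↦
    ∏ j, (‖φ j i ((U j).orthogonalProjectionOnto x)‖ₑ ^ 2 + ENNReal.ofReal (δ i)) ^ θ j with hG
  set R : ℕ → ℝ≥0∞ := fun i ↦ ∏ j, ((eLpNorm (u j) 2 (stdGaussian (U j))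
    + ENNReal.ofReal (δ i)) ^ 2 + ENNReal.ofReal (δ i)) ^ θ j with hR
  have hGR : ∀ i, ∫⁻ x, G i x ∂(stdGaussian E) ≤ R i := fun i ↦ by
    refine (lintegral_prod_rpow_le_of_contDiff hθ hquad (fun j ↦ hφ j i) (fun j ↦ hφc j i)
      (hδ0 i)).trans (Finset.prod_le_prod' fun j _ ↦ ENNReal.rpow_le_rpow ?_ (hθ j))
    rw [lintegral_add_right _ measurable_const]
    simpa [hδ] using add_le_add_left (hle j i) (ENNReal.ofReal (δ i))
  have hGm : ∀ i, Measurable (G i) := fun i ↦ by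
    simp only [hG]
    fun_prop
  have hae' : ∀ᵐ x ∂(stdGaussian E), ∀ j, Tendsto
      (fun i ↦ φ j i ((U j).orthogonalProjectionOnto x)) atTop
      (𝓝 (u j ((U j).orthogonalProjectionOnto x))) := by
    refine ae_all_iff.2 fun j ↦ ?_
    have h := hae j
    rw [← stdGaussian_map_orthogonalProjectionOnto (U j)] at h
    exact ae_of_ae_map (by fun_prop) h
  have hGlim : ∀ᵐ x ∂(stdGaussian E), ∏ j, (‖u j ((U j).orthogonalProjectionOnto x)‖ₑ ^ 2) ^ θ j
      = liminf (fun i ↦ G i x) atTop := by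
    filter_upwards [hae'] with x hx
    refine (Tendsto.liminf_eq ?_).symm
    refine ENNReal.tendsto_finsetProd_of_ne_top _ (fun j _ ↦ ?_) fun j _ ↦
      ENNReal.rpow_ne_top_of_nonneg (hθ j) (by simp)
    refine (ENNReal.continuous_rpow_const.tendsto _).comp ?_
    simpa using (((ENNReal.continuous_pow 2).tendsto _).comp (hx j).enorm).add hδlim
  have hRlim : Tendsto R atTop
      (𝓝 (∏ j, (∫⁻ y, ‖u j y‖ₑ ^ 2 ∂(stdGaussian (U j))) ^ θ j)) := by
    have h1 : ∀ j, ∫⁻ y, ‖u j y‖ₑ ^ 2 ∂(stdGaussian (U j))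
        = eLpNorm (u j) 2 (stdGaussian (U j)) ^ 2 := fun j ↦ by
      have := eLpNorm_nnreal_pow_eq_lintegral (μ := stdGaussian (U j)) (f := u j) (p := 2)
        two_ne_zero
      simpa using this.symm
    simp_rw [h1]
    refine ENNReal.tendsto_finsetProd_of_ne_top _ (fun j _ ↦ ?_) fun j _ ↦
      ENNReal.rpow_ne_top_of_nonneg (hθ j) (ENNReal.pow_ne_top (hu j).eLpNorm_ne_top)
    refine (ENNReal.continuous_rpow_const.tendsto _).comp ?_
    have h2 := (tendsto_const_nhds (x := eLpNorm (u j) 2 (stdGaussian (U j)))).add hδlim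
    simpa using (((ENNReal.continuous_pow 2).tendsto _).comp h2).add hδlim
  calc _ = ∫⁻ x, liminf (fun i ↦ G i x) atTop ∂(stdGaussian E) := lintegral_congr_ae hGlim
    _ ≤ liminf (fun i ↦ ∫⁻ x, G i x ∂(stdGaussian E)) atTop := lintegral_liminf_le hGm
    _ ≤ liminf R atTop := liminf_le_liminf (.of_forall hGR)
    _ = _ := hRlim.liminf_eq

/-- The Gaussian inequality with constant `1` for bounded measurable functions. -/
lemma lintegral_prod_le_of_bounded {p : ι → ℝ} (hp : ∀ j, 0 < p j)
    (hquad : ∀ w : ∀ j, U j, ‖∑ j, (1 / p j) • (w j : E)‖ ^ 2 ≤ ∑ j, 1 / p j * ‖w j‖ ^ 2)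
    {f : ∀ j, U j → ℝ≥0} (hf : ∀ j, Measurable (f j)) {c : ℝ≥0} (hc : ∀ j y, f j y ≤ c) :
    ∫⁻ x, ∏ j, (f j ((U j).orthogonalProjectionOnto x) : ℝ≥0∞) ∂(stdGaussian E)
      ≤ ∏ j, (∫⁻ y, (f j y : ℝ≥0∞) ^ p j ∂(stdGaussian (U j))) ^ (1 / p j) := by
  -- `u j = f j ^ (p j / 2)` is the square root of `f j ^ p j`
  have hu : ∀ j, MemLp (fun y ↦ ((f j y ^ (p j / 2) : ℝ≥0) : ℝ)) 2 (stdGaussian (U j)) := fun j ↦ by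
    refine MemLp.of_bound
      ((hf j).pow_const (p j / 2)).coe_nnreal_real.aestronglyMeasurable
      ((c ^ (p j / 2) : ℝ≥0) : ℝ) (.of_forall fun y ↦ ?_)
    rw [Real.norm_of_nonneg NNReal.zero_le_coe, NNReal.coe_le_coe]
    exact NNReal.rpow_le_rpow (hc j y) (by linarith [hp j])
  have hsq : ∀ j y, ‖((f j y ^ (p j / 2) : ℝ≥0) : ℝ)‖ₑ ^ 2 = (f j y : ℝ≥0∞) ^ p j := fun j y ↦ by
    rw [Real.enorm_eq_ofReal NNReal.zero_le_coe, ENNReal.ofReal_coe_nnreal, ← ENNReal.coe_pow,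
      ← NNReal.rpow_natCast, ← NNReal.rpow_mul, ← ENNReal.coe_rpow_of_nonneg _ (hp j).le]
    norm_num
  have h := lintegral_prod_rpow_le_of_memLp_two (fun j ↦ (one_div_pos.2 (hp j)).le) hquad hu
  simp_rw [hsq] at h
  refine (le_of_eq ?_).trans h
  refine lintegral_congr fun x ↦ Finset.prod_congr rfl fun j _ ↦ ?_
  rw [← ENNReal.rpow_mul, mul_one_div_cancel (hp j).ne', ENNReal.rpow_one]

/-- The Gaussian inequality with constant `1`. -/
lemma lintegral_prod_le {p : ι → ℝ} (hp : ∀ j, 0 < p j)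
    (hquad : ∀ w : ∀ j, U j, ‖∑ j, (1 / p j) • (w j : E)‖ ^ 2 ≤ ∑ j, 1 / p j * ‖w j‖ ^ 2)
    {f : ∀ j, U j → ℝ≥0} (hf : ∀ j, Measurable (f j)) :
    ∫⁻ x, ∏ j, (f j ((U j).orthogonalProjectionOnto x) : ℝ≥0∞) ∂(stdGaussian E)
      ≤ ∏ j, (∫⁻ y, (f j y : ℝ≥0∞) ^ p j ∂(stdGaussian (U j))) ^ (1 / p j) := by
  set G : ℕ → E → ℝ≥0∞ := fun i x ↦
    ∏ j, ((min (f j ((U j).orthogonalProjectionOnto x)) i : ℝ≥0) : ℝ≥0∞) with hG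
  have hGm : ∀ i, Measurable (G i) := fun i ↦ by
    simp only [hG]
    fun_prop
  -- the truncation is inactive at a given point once the level is large
  have hGlim : ∀ x, ∏ j, (f j ((U j).orthogonalProjectionOnto x) : ℝ≥0∞)
      = liminf (fun i ↦ G i x) atTop := fun x ↦ by
    refine (Tendsto.liminf_eq (tendsto_const_nhds.congr' ?_)).symm
    have h : ∀ j, ∀ᶠ i : ℕ in atTop, f j ((U j).orthogonalProjectionOnto x) ≤ i := fun j ↦
      tendsto_natCast_atTop_atTop.eventually_ge_atTop _
    filter_upwards [eventually_all.2 h] with i hi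
    exact Finset.prod_congr rfl fun j _ ↦ by rw [min_eq_left (hi j)]
  simp_rw [hGlim]
  refine (lintegral_liminf_le hGm).trans ?_
  refine liminf_le_of_frequently_le' (.of_forall fun i ↦ ?_)
  refine (lintegral_prod_le_of_bounded hp hquad (f := fun j y ↦ min (f j y) i) (c := i)
    (fun j ↦ (hf j).min measurable_const) fun j y ↦ min_le_right _ _).trans ?_
  refine Finset.prod_le_prod' fun j _ ↦
    ENNReal.rpow_le_rpow (lintegral_mono fun y ↦ ?_) (one_div_pos.2 (hp j)).le
  exact ENNReal.rpow_le_rpow (ENNReal.coe_le_coe.2 (min_le_left _ _)) (hp j).le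

end Measurable

/-! ### The operator inequality -/

section Operator

variable {E : Type*} [NormedAddCommGroup E] [InnerProductSpace ℝ E] [FiniteDimensional ℝ E]
  {ι : Type*} [Fintype ι] {U : ι → Submodule ℝ E} {θ : ι → ℝ}

open scoped RealInnerProductSpace

lemma inner_sum_smul_starProjection_self (x : E) :
    ⟪(∑ j, θ j • (U j).starProjection) x, x⟫
      = ∑ j, θ j * ‖(U j).orthogonalProjectionOnto x‖ ^ 2 := by
  simp only [sum_apply, smul_apply, sum_inner,
    real_inner_smul_left]
  refine Finset.sum_congr rfl fun j _ ↦ ?_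
  rw [Submodule.starProjection_apply, ← Submodule.inner_orthogonalProjectionOnto_eq_of_mem_left,
    real_inner_self_eq_norm_sq]

lemma sum_smul_starProjection_le_id_iff :
    ∑ j, θ j • (U j).starProjection ≤ ContinuousLinearMap.id ℝ E ↔
      ∀ x : E, ∑ j, θ j * ‖(U j).orthogonalProjectionOnto x‖ ^ 2 ≤ ‖x‖ ^ 2 := by
  rw [ContinuousLinearMap.le_def, ContinuousLinearMap.isPositive_iff]
  have hsymm : ((ContinuousLinearMap.id ℝ E - ∑ j, θ j • (U j).starProjection : E →L[ℝ] E) :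
      E →ₗ[ℝ] E).IsSymmetric := fun x y ↦ by
    simp [inner_sub_left, inner_sub_right, sum_inner, inner_sum, real_inner_smul_left,
      real_inner_smul_right, Submodule.inner_starProjection_left_eq_right]
  rw [and_iff_right hsymm]
  refine forall_congr' fun x ↦ ?_
  rw [sub_apply, inner_sub_left, inner_sum_smul_starProjection_self,
    ContinuousLinearMap.id_apply, real_inner_self_eq_norm_sq, sub_nonneg]

/-- The dual form of the operator inequality. With `S = ∑ j, θ j • w j` one has
`‖S‖² = ∑ j, θ j * ⟪w j, P j S⟫`, and the arithmetic-geometric inequality bounds this by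
`(∑ j, θ j * ‖w j‖²) / 2 + ‖S‖² / 2`. -/
lemma norm_sum_smul_sq_le (hθ : ∀ j, 0 ≤ θ j)
    (h : ∀ x : E, ∑ j, θ j * ‖(U j).orthogonalProjectionOnto x‖ ^ 2 ≤ ‖x‖ ^ 2) (w : ∀ j, U j) :
    ‖∑ j, θ j • (w j : E)‖ ^ 2 ≤ ∑ j, θ j * ‖w j‖ ^ 2 := by
  set S := ∑ j, θ j • (w j : E) with hS
  have h1 : ‖S‖ ^ 2 = ∑ j, θ j * ⟪w j, (U j).orthogonalProjectionOnto S⟫ := by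
    rw [← real_inner_self_eq_norm_sq]
    nth_rw 1 [hS]
    rw [sum_inner]
    refine Finset.sum_congr rfl fun j _ ↦ ?_
    rw [real_inner_smul_left, Submodule.inner_orthogonalProjectionOnto_eq_of_mem_left]
  have h2 : ∑ j, θ j * ⟪w j, (U j).orthogonalProjectionOnto S⟫
      ≤ ∑ j, (θ j * ‖w j‖ ^ 2 / 2 + θ j * ‖(U j).orthogonalProjectionOnto S‖ ^ 2 / 2) := by
    refine Finset.sum_le_sum fun j _ ↦ ?_
    have h3 := real_inner_le_norm (w j) ((U j).orthogonalProjectionOnto S)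
    have h4 := two_mul_le_add_sq ‖w j‖ ‖(U j).orthogonalProjectionOnto S‖
    have := mul_le_mul_of_nonneg_left (h3.trans (b := ‖w j‖ * _) (by
      show _ ≤ (‖w j‖ ^ 2 + ‖(U j).orthogonalProjectionOnto S‖ ^ 2) / 2
      linarith)) (hθ j)
    linarith
  rw [Finset.sum_add_distrib, ← Finset.sum_div, ← Finset.sum_div] at h2
  linarith [h S]

/-- Conversely, it suffices to test the dual inequality on the vectors `w j = P j x`. -/
lemma sum_mul_norm_sq_le_of_norm_sum_smul_sq_le
    (h : ∀ w : ∀ j, U j, ‖∑ j, θ j • (w j : E)‖ ^ 2 ≤ ∑ j, θ j * ‖w j‖ ^ 2) (x : E) :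
    ∑ j, θ j * ‖(U j).orthogonalProjectionOnto x‖ ^ 2 ≤ ‖x‖ ^ 2 := by
  have h1 := h fun j ↦ (U j).orthogonalProjectionOnto x
  have h2 : ⟪∑ j, θ j • ((U j).orthogonalProjectionOnto x : E), x⟫
      = ∑ j, θ j * ‖(U j).orthogonalProjectionOnto x‖ ^ 2 := by
    rw [← inner_sum_smul_starProjection_self]
    simp only [sum_apply, smul_apply, Submodule.starProjection_apply]
  have h3 := real_inner_le_norm (∑ j, θ j • ((U j).orthogonalProjectionOnto x : E)) x
  have h4 := norm_nonneg (∑ j, θ j • ((U j).orthogonalProjectionOnto x : E))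
  nlinarith [norm_nonneg x,
    sq_nonneg (‖∑ j, θ j • ((U j).orthogonalProjectionOnto x : E)‖ - ‖x‖)]

end Operator

/-! ### Exponential test functions -/

section Necessity

variable {n N : ℕ} {V : Fin N → Submodule ℝ (EuclideanSpace ℝ (Fin n))} {p : Fin N → ℝ}

open scoped RealInnerProductSpace

/-- The Brascamp-Lieb inequality for the functions `y ↦ exp ⟪w j, y⟫`, both sides of which are
explicit. -/
lemma GaussianBrascampLieb.exp_norm_sq_le {C : ℝ≥0} (h : GaussianBrascampLieb V p C)
    (hp : ∀ j, 0 < p j) (w : ∀ j, V j) :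
    Real.exp (‖∑ j, (w j : EuclideanSpace ℝ (Fin n))‖ ^ 2 / 2)
      ≤ C * Real.exp ((∑ j, p j * ‖w j‖ ^ 2) / 2) := by
  have h1 := h (fun j y ↦ (Real.exp ⟪w j, y⟫).toNNReal) fun j ↦ by fun_prop
  have hL : ∀ x, ∏ j, (((Real.exp ⟪w j, (V j).orthogonalProjectionOnto x⟫).toNNReal : ℝ≥0) : ℝ≥0∞)
      = ENNReal.ofReal (Real.exp ⟪∑ j, (w j : EuclideanSpace ℝ (Fin n)), x⟫) := fun x ↦ by
    rw [sum_inner, Real.exp_sum, ENNReal.ofReal_prod_of_nonneg fun j _ ↦ (Real.exp_pos _).le]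
    refine Finset.prod_congr rfl fun j _ ↦ ?_
    rw [Submodule.inner_orthogonalProjectionOnto_eq_of_mem_left]
    rfl
  have hR : ∀ j, (∫⁻ y, (((Real.exp ⟪w j, y⟫).toNNReal : ℝ≥0) : ℝ≥0∞) ^ p j
      ∂(stdGaussian (V j))) ^ (1 / p j) = ENNReal.ofReal (Real.exp (p j * ‖w j‖ ^ 2 / 2)) := by
    intro j
    have h2 : ∀ y, (((Real.exp ⟪w j, y⟫).toNNReal : ℝ≥0) : ℝ≥0∞) ^ p j
        = ENNReal.ofReal (Real.exp ⟪p j • w j, y⟫) := fun y ↦ by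
      change ENNReal.ofReal _ ^ p j = _
      rw [ENNReal.ofReal_rpow_of_nonneg (Real.exp_pos _).le (hp j).le, ← Real.exp_mul,
        mul_comm]
      exact congrArg _ (congrArg _ (real_inner_smul_left (w j) y (p j)).symm)
    simp_rw [h2]
    rw [lintegral_exp_inner_stdGaussian, ENNReal.ofReal_rpow_of_nonneg (Real.exp_pos _).le
      (one_div_pos.2 (hp j)).le, ← Real.exp_mul, norm_smul, Real.norm_of_nonneg (hp j).le]
    congr 2
    field_simp [(hp j).ne']
  simp_rw [hL, hR] at h1
  rw [lintegral_exp_inner_stdGaussian, ← ENNReal.ofReal_prod_of_nonneg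
    fun j _ ↦ (Real.exp_pos _).le, ← ENNReal.ofReal_coe_nnreal, ← ENNReal.ofReal_mul
    NNReal.zero_le_coe, ENNReal.ofReal_le_ofReal_iff (by positivity), ← Real.exp_sum,
    ← Finset.sum_div] at h1
  exact h1

/-- Rescaling the exponents of the test functions to infinity makes the constant `C` irrelevant. -/
lemma GaussianBrascampLieb.norm_sum_sq_le {C : ℝ≥0} (h : GaussianBrascampLieb V p C)
    (hp : ∀ j, 0 < p j) (w : ∀ j, V j) :
    ‖∑ j, (w j : EuclideanSpace ℝ (Fin n))‖ ^ 2 ≤ ∑ j, p j * ‖w j‖ ^ 2 := by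
  by_contra! hlt
  set q := ‖∑ j, (w j : EuclideanSpace ℝ (Fin n))‖ ^ 2 - ∑ j, p j * ‖w j‖ ^ 2 with hq
  have hq0 : 0 < q := sub_pos.2 hlt
  -- `t ^ 2 * q / 2 = C`, while the inequality for `t • w` gives `exp (t ^ 2 * q / 2) ≤ C`
  set t := √(2 * C / q) with ht
  have ht2 : t ^ 2 * q / 2 = C := by
    rw [ht, Real.sq_sqrt (by positivity)]
    field_simp
  have h1 := h.exp_norm_sq_le hp fun j ↦ t • w j
  have h2 : ‖∑ j, ((t • w j : V j) : EuclideanSpace ℝ (Fin n))‖ ^ 2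
      = t ^ 2 * ‖∑ j, (w j : EuclideanSpace ℝ (Fin n))‖ ^ 2 := by
    simp_rw [Submodule.coe_smul, ← Finset.smul_sum, norm_smul, mul_pow, Real.norm_eq_abs, sq_abs]
  have h3 : ∑ j, p j * ‖t • w j‖ ^ 2 = t ^ 2 * ∑ j, p j * ‖w j‖ ^ 2 := by
    simp_rw [norm_smul, mul_pow, Real.norm_eq_abs, sq_abs, Finset.mul_sum]
    exact Finset.sum_congr rfl fun j _ ↦ by ring
  rw [h2, h3, ← div_le_iff₀ (Real.exp_pos _), ← Real.exp_sub] at h1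
  have h4 : t ^ 2 * ‖∑ j, (w j : EuclideanSpace ℝ (Fin n))‖ ^ 2 / 2
      - t ^ 2 * (∑ j, p j * ‖w j‖ ^ 2) / 2 = C := by
    rw [← ht2, hq]; ring
  rw [h4] at h1
  linarith [Real.add_one_le_exp (C : ℝ)]

/-- Constant test functions show that no constant below `1` is admissible. -/
lemma GaussianBrascampLieb.one_le {C : ℝ≥0} (h : GaussianBrascampLieb V p C) : 1 ≤ C := by
  have h1 := h (fun _ _ ↦ 1) fun _ ↦ measurable_const
  simpa using h1

end Necessity

theorem mainTheorem6 {n N : ℕ} (V : Fin N → Submodule ℝ (EuclideanSpace ℝ (Fin n)))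
    (hV : ∀ j, V j ≠ ⊥) (p : Fin N → ℝ) (hp : ∀ j, 1 ≤ p j) :
    ((∃ C : ℝ≥0, GaussianBrascampLieb V p C) ↔
      ∑ j, (1 / p j) • (V j).starProjection ≤
        ContinuousLinearMap.id ℝ (EuclideanSpace ℝ (Fin n))) ∧
    (∑ j, (1 / p j) • (V j).starProjection ≤
        ContinuousLinearMap.id ℝ (EuclideanSpace ℝ (Fin n)) →
      IsLeast {C : ℝ≥0 | GaussianBrascampLieb V p C} 1) := by
  have hp0 : ∀ j, 0 < p j := fun j ↦ zero_lt_one.trans_le (hp j)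
  have hsuff : ∑ j, (1 / p j) • (V j).starProjection ≤
      ContinuousLinearMap.id ℝ (EuclideanSpace ℝ (Fin n)) → GaussianBrascampLieb V p 1 := by
    intro h f hf
    rw [ENNReal.coe_one, one_mul]
    exact lintegral_prod_le hp0 (norm_sum_smul_sq_le (fun j ↦ (one_div_pos.2 (hp0 j)).le)
      (sum_smul_starProjection_le_id_iff.1 h)) hf
  refine ⟨⟨?_, fun h ↦ ⟨1, hsuff h⟩⟩, fun h ↦ ⟨hsuff h, fun C hC ↦ hC.one_le⟩⟩
  rintro ⟨C, hC⟩
  refine sum_smul_starProjection_le_id_iff.2 (sum_mul_norm_sq_le_of_norm_sum_smul_sq_le fun w ↦ ?_)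
  refine (hC.norm_sum_sq_le hp0 fun j ↦ (1 / p j) • w j).trans_eq ?_
  refine Finset.sum_congr rfl fun j _ ↦ ?_
  rw [norm_smul, Real.norm_of_nonneg (one_div_pos.2 (hp0 j)).le]
  field_simp [(hp0 j).ne']
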